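/- Let $\mathbb H=(V,E)$ be a finite hypergraph: $V$ and $E$ are finite sets, every hyperedge $e\in E$ has a nonempty set of hypervertices in $V$ (different hyperedges may have the same hypervertices), and the hyperedges cover $V$. A closed path of length $k\ge 1$ in $\mathbb H$ is a sequence $c=(v_1,e_1,v_2,e_2,\dots,v_k,e_k,v_1)$ with $v_i,v_{i+1}\in e_i$ and $v_i\neq v_{i+1}$ (indices modulo $k$). It has hyperedge backtracking if it has a subsequence $(e,v,e)$, and it is tail-less if $c^2$ has no hyperedge backtracking, where $c^m$ means going around $c$ $m$ times. It is a primitive cycle if it has no hyperedge backtracking, is tail-less, and is not $b^m$ for a closed path $b$ and some $m\ge 2$. A prime cycle is a class of primitive cycles under cyclic permutation; $|\mathfrak p|$ is its length. Put $\zeta_{\mathbb H}(u)=\prod_{\mathfrak p}(1-u^{|\mathfrak p|})^{-1}$, over all prime cycles $\mathfrak p$ of $\mathbb H$, for $|u|$ sufficiently small. The oriented line graph $\mathbb H_L^o$ has as vertices all $\{v,w\}_e$ with $e\in E$ and $v,w\in e$, $v\ne w$ (the edge from $v$ to $w$ of colour $e$), and an oriented edge from $\{v,w\}_e$ to $\{v',w'\}_{e'}$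 exactly when $e\neq e'$ and $w=v'$. An admissible closed path of length $k\ge1$ in $\mathbb H_L^o$ is a cyclic sequence of $k$ oriented edges, each starting where the preceding one ends; an admissible prime cycle is a class, under cyclic permutation, of admissible closed paths that are not $m$-multiples, $m\ge2$, of an admissible closed path. The Perron–Frobenius operator $T$ acts on the functions $f:V_L\to\mathbb C$ on the vertices of $\mathbb H_L^o$ by $(Tf)(x)=\sum_{o(a)=x}f(t(a))$, the sum being over the oriented edges $a$ with origin $x$, and $t(a)$ being the terminus of $a$. Then there is a bijection from the prime cycles of $\mathbb H$ to the admissible prime cycles of $\mathbb H_L^o$ which preserves length; it sends the class of $(v_1,e_1,\dots,v_k,e_k,v_1)$ to the class of the closed path through the vertices $\{v_1,v_2\}_{e_1},\{v_2,v_3\}_{e_2},\dots,\{v_k,v_1\}_{e_k}$. Consequently there is $r>0$ such that for all $u\in\mathbb C$ with $|u|<r$ the product defining $\zeta_{\mathbb H}(u)$ converges, $\det(I-uT)\neq0$, and $$\zeta_{\mathbb H}(u)=\det(I-uT)^{-1}.$$ In particular $\zeta_{\mathbb H}$ is a rational function: there is a polynomial $Q\in\mathbb C[u]$ with $Q(u)\neq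 0$ and $\zeta_{\mathbb H}(u)=1/Q(u)$ for $|u|<r$. -/

import Mathlib

open scoped Polynomial

/-! ### Closed sequences and cyclic permutation -/

/-- A closed sequence `(a_0, a_1, …, a_{k-1})` of positive length `k`, its indices being read
modulo `k`: it is stored as a `k`-periodic function on `ℕ`. -/
@[ext]
structure ClosedSeq (α : Type*) where
  /-- the length `k` -/
  length : ℕ
  length_pos : 0 < length
  /-- the entries `a_i`, with `i` read modulo `k` -/
  entry : ℕ → α
  periodic : ∀ i, entry (i + length) = entry i

namespace ClosedSeq

variable {α : Type*}

theorem periodic_mul (c : ClosedSeq α) (m i : ℕ) : c.entry (i + m * c.length) = c.entry i := by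
  induction m with
  | zero => simp
  | succ m ih => rw [Nat.succ_mul, ← Nat.add_assoc, c.periodic, ih]

/-- The `m`-multiple of `c`: going `m` times around `c`. -/
def multiple (c : ClosedSeq α) (m : ℕ+) : ClosedSeq α where
  length := m * c.length
  length_pos := Nat.mul_pos m.pos c.length_pos
  entry := c.entry
  periodic := c.periodic_mul m

/-- `d` arises from `c` by a cyclic permutation. -/
def IsRotation (c d : ClosedSeq α) : Prop :=
  d.length = c.length ∧ ∃ s : ℕ, ∀ i, d.entry i = c.entry (i + s)

/-- Cyclic permutation is an equivalence relation. -/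
def rotationSetoid (α : Type*) : Setoid (ClosedSeq α) where
  r := IsRotation
  iseqv :=
    { refl := fun _ => ⟨rfl, 0, fun _ => rfl⟩
      symm := by
        rintro c d ⟨hl, s, hs⟩
        refine ⟨hl.symm, s * c.length - s, fun i => ?_⟩
        have h : s ≤ s * c.length := Nat.le_mul_of_pos_right s c.length_pos
        rw [hs, Nat.add_assoc, Nat.sub_add_cancel h, c.periodic_mul]
      trans := by
        rintro a b c ⟨hl, s, hs⟩ ⟨hl', t, ht⟩
        exact ⟨hl'.trans hl, t + s, fun i => by rw [ht, hs, Nat.add_assoc]⟩ }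

end ClosedSeq

/-! ### Oriented graphs: admissible prime cycles and the Perron–Frobenius operator -/

namespace Digraph

variable {α : Type*}

/-- An oriented edge of `X`: an ordered pair of vertices which belongs to `X`. -/
@[ext]
structure OEdge (X : Digraph α) where
  /-- the origin `o(e)` -/
  origin : α
  /-- the terminus `t(e)` -/
  terminus : α
  adj : X.Adj origin terminus

/-- `c = (e_0, …, e_{k-1})` is an admissible closed path: each edge (cyclically) starts where the
preceding one ends. -/
def IsAdmissibleClosed (X : Digraph α) (c : ClosedSeq X.OEdge) : Prop :=
  ∀ i, (c.entry (i + 1)).origin = (c.entry i).terminus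

/-- A primitive admissible cycle: an admissible closed path which is not the `m`-multiple, `m ≥ 2`,
of an admissible closed path. -/
def IsPrimitive (X : Digraph α) (c : ClosedSeq X.OEdge) : Prop :=
  X.IsAdmissibleClosed c ∧
    ∀ (b : ClosedSeq X.OEdge) (m : ℕ+), X.IsAdmissibleClosed b → 2 ≤ m → c ≠ b.multiple m

/-- The primitive admissible cycles of `X`. -/
def PrimitiveCycle (X : Digraph α) : Type _ := {c : ClosedSeq X.OEdge // X.IsPrimitive c}

/-- Primitive admissible cycles up to cyclic permutation. -/
instance primitiveSetoid (X : Digraph α) : Setoid X.PrimitiveCycle :=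
  (ClosedSeq.rotationSetoid X.OEdge).comap Subtype.val

/-- The admissible prime cycles of `X`: classes of primitive admissible cycles under cyclic
permutation. -/
def PrimeCycle (X : Digraph α) : Type _ := Quotient X.primitiveSetoid

/-- The length of an admissible prime cycle. -/
def PrimeCycle.length {X : Digraph α} (p : X.PrimeCycle) : ℕ :=
  Quotient.lift (fun c : X.PrimitiveCycle => c.1.length) (fun _ _ h => (And.left h).symm) p

open scoped Classical in
/-- The Perron–Frobenius operator `(Tf)(x) = ∑ f(t(e))` over the edges `e` with origin `x`, on the
complex functions on the vertices. The edges with origin `x` are the pairs `(x, y)` with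
`X.Adj x y`. -/
noncomputable def perronFrobenius [Fintype α] (X : Digraph α) : (α → ℂ) →ₗ[ℂ] (α → ℂ) where
  toFun f x := ∑ y with X.Adj x y, f y
  map_add' f g := by
    funext x
    simp [Finset.sum_add_distrib]
  map_smul' a f := by
    funext x
    simp [Finset.mul_sum]

end Digraph

/-! ### Hypergraphs with possibly repeated hyperedges -/

/-- A hypergraph with hypervertices `V` and hyperedges `E`. Every `e : E` has a nonempty set of
hypervertices; different `e` may have the same set (repeated hyperedges); the hyperedges cover
`V`. -/
structure MultiHypergraph (V E : Type*) where
  /-- the set of hypervertices in a hyperedge -/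
  verts : E → Set V
  verts_nonempty : ∀ e, (verts e).Nonempty
  iUnion_verts : ⋃ e, verts e = Set.univ

namespace MultiHypergraph

variable {V E : Type*}

/-- The sequence `(v_0, e_0), …, (v_{k-1}, e_{k-1})` is the closed path
`(v_0, e_0, v_1, e_1, …, v_{k-1}, e_{k-1}, v_0)`: one has `v_i, v_{i+1} ∈ e_i`, and each hyperedge
is used to pass from a hypervertex to a different one. -/
def IsClosedPath (H : MultiHypergraph V E) (c : ClosedSeq (V × E)) : Prop :=
  ∀ i, (c.entry i).1 ∈ H.verts (c.entry i).2 ∧ (c.entry (i + 1)).1 ∈ H.verts (c.entry i).2 ∧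
    (c.entry i).1 ≠ (c.entry (i + 1)).1

/-- Hyperedge backtracking: `(v_0, e_0, …, v_{k-1}, e_{k-1}, v_0)` has a subsequence `(e, v, e)`. -/
def HasBacktracking (c : ClosedSeq (V × E)) : Prop :=
  ∃ i, i + 1 < c.length ∧ (c.entry i).2 = (c.entry (i + 1)).2

/-- `c` is tail-less: `c ^ 2` has no hyperedge backtracking. -/
def IsTailless (c : ClosedSeq (V × E)) : Prop := ¬ HasBacktracking (c.multiple 2)

/-- A primitive cycle: a tail-less closed path without hyperedge backtracking which is not the
`m`-multiple, `m ≥ 2`, of a closed path. -/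
def IsPrimitive (H : MultiHypergraph V E) (c : ClosedSeq (V × E)) : Prop :=
  H.IsClosedPath c ∧ ¬ HasBacktracking c ∧ IsTailless c ∧
    ∀ (b : ClosedSeq (V × E)) (m : ℕ+), H.IsClosedPath b → 2 ≤ m → c ≠ b.multiple m

/-- The primitive cycles of `H`. -/
def PrimitiveCycle (H : MultiHypergraph V E) : Type _ :=
  {c : ClosedSeq (V × E) // H.IsPrimitive c}

/-- Primitive cycles up to cyclic permutation. -/
instance primitiveSetoid (H : MultiHypergraph V E) : Setoid H.PrimitiveCycle :=
  (ClosedSeq.rotationSetoid (V × E)).comap Subtype.val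

/-- The prime cycles of `H`: classes of primitive cycles under cyclic permutation. -/
def PrimeCycle (H : MultiHypergraph V E) : Type _ := Quotient H.primitiveSetoid

/-- The length of a prime cycle. -/
def PrimeCycle.length {H : MultiHypergraph V E} (p : H.PrimeCycle) : ℕ :=
  Quotient.lift (fun c : H.PrimitiveCycle => c.1.length) (fun _ _ h => (And.left h).symm) p

/-- The Euler factor `(1 - u ^ |p|)⁻¹` of a prime cycle. -/
noncomputable def eulerFactor (H : MultiHypergraph V E) (u : ℂ) (p : H.PrimeCycle) : ℂ :=
  (1 - u ^ p.length)⁻¹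

/-- The generalized Ihara–Selberg zeta function `ζ_H(u) = ∏ (1 - u ^ |p|)⁻¹` over all prime
cycles `p` of `H` (for `|u|` small, where the product converges). -/
noncomputable def zeta (H : MultiHypergraph V E) (u : ℂ) : ℂ := ∏' p, H.eulerFactor u p

/-- The coloured oriented edges `{v, w}_e`: the two orientations of all edges of the edge-coloured
graph on `V` which is the union of one clique, with its own colour `e`, on the hypervertices of each
hyperedge `e`. -/
@[ext]
structure ColoredEdge (H : MultiHypergraph V E) where
  /-- the origin `v` -/
  origin : V
  /-- the terminus `w` -/
  terminus : V
  /-- the colour, that is, the hyperedge `e` -/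
  color : E
  origin_mem : origin ∈ H.verts color
  terminus_mem : terminus ∈ H.verts color
  origin_ne_terminus : origin ≠ terminus

instance (H : MultiHypergraph V E) [Finite V] [Finite E] : Finite H.ColoredEdge :=
  Finite.of_injective (fun x => (x.origin, x.terminus, x.color)) (by
    intro x y h
    simp only [Prod.mk.injEq] at h
    exact ColoredEdge.ext h.1 h.2.1 h.2.2)

noncomputable instance (H : MultiHypergraph V E) [Finite V] [Finite E] : Fintype H.ColoredEdge :=
  Fintype.ofFinite _

/-- The oriented line graph of `H`: its vertices are the coloured oriented edges, and `(x, y)` is an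
oriented edge when `x` and `y` have different colours and `x` ends where `y` starts. -/
def orientedLineGraph (H : MultiHypergraph V E) : Digraph H.ColoredEdge where
  Adj x y := x.color ≠ y.color ∧ x.terminus = y.origin

end MultiHypergraph

/-! ### Eigenvalues, traces of powers and the determinant -/

namespace Matrix

open Polynomial

variable {n K : Type*} [Fintype n] [DecidableEq n] [Field K] [IsAlgClosed K]

/-! A closed path whose consecutive hyperedges differ cyclically is coded by its steps `{v_i,
v_{i+1}}_{e_i}`, and "consecutive hyperedges differ" is exactly adjacency in the oriented line
graph. The code commutes with the shift and loses nothing, so it preserves least periods and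
rotations. A closed path is primitive exactly when its length is its least period
(`ClosedSeq.not_multiple_iff`), so the code gives the bijection `MultiHypergraph.primeEquiv`.

The determinant formula holds for any finite oriented graph, with adjacency matrix `A`, the matrix
of `T`. Summing `-log (1 - u y)` over the eigenvalues `y` shows that `∑ tr (A ^ k) u ^ k / k` is a
logarithm of `det (1 - u A)⁻¹`. As `tr (A ^ k)` counts the closed paths of length `k > 0`, this
series is the sum of `u ^ |c| / |c|` over closed paths `c`. Each `c` is uniquely a multiple of a
primitive one (`Digraph.primitiveMultipleEquiv`); summing over multiples gives `-log (1 - u ^ |q|) /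
|q|` for each primitive `q`. The class of `q` has `|q|` members (`Digraph.nat_card_fiber`), which
cancels the denominator. Exponentiating yields the Euler product. -/

theorem card_roots_charpoly (A : Matrix n n K) : A.charpoly.roots.card = Fintype.card n := by
  rw [← (IsAlgClosed.splits A.charpoly).natDegree_eq_card_roots, charpoly_natDegree_eq_dim]

theorem det_sub_algebraMap (A : Matrix n n K) (x : K) :
    (A - algebraMap K (Matrix n n K) x).det = (A.charpoly.roots.map fun y => y - x).prod := by
  have h : A.charpoly.eval x = (A.charpoly.roots.map fun y => x - y).prod := by
    conv_lhs => rw [(IsAlgClosed.splits A.charpoly).eq_prod_roots_of_monic A.charpoly_monic]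
    rw [eval_multiset_prod, Multiset.map_map]
    simp
  rw [← neg_sub, det_neg, ← card_roots_charpoly A]
  have h2 : (algebraMap K (Matrix n n K) x - A).det = A.charpoly.eval x := by
    rw [eval_charpoly]; rfl
  rw [h2, h]
  -- The sign `(-1) ^ n` is spread over the `n` roots, one factor each.
  have := Multiset.prod_map_mul (m := A.charpoly.roots) (f := fun _ => (-1 : K))
    (g := fun y => x - y)
  simpa using this.symm

/-- The determinant of a polynomial in `A` is the product of its values at the eigenvalues. -/
theorem det_aeval (A : Matrix n n K) (p : K[X]) :
    (aeval A p).det = (A.charpoly.roots.map fun y => p.eval y).prod := by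
  -- Both sides are multiplicative in `p`, so linear factors suffice; the leading coefficient `a`
  -- contributes `a ^ n` to either side.
  have h : ∀ s : Multiset K, (aeval A (s.map fun a => X - C a).prod).det =
      (A.charpoly.roots.map fun y => ((s.map fun a => X - C a).prod).eval y).prod := by
    intro s
    induction s using Multiset.induction_on with
    | empty => simp
    | cons a s ih =>
      simp only [Multiset.map_cons, Multiset.prod_cons, map_mul, det_mul, ih, eval_mul,
        Multiset.prod_map_mul]
      congr 1
      simpa using det_sub_algebraMap A a
  rw [(IsAlgClosed.splits p).eq_prod_roots, map_mul, det_mul, h]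
  simp only [eval_mul, Multiset.prod_map_mul, aeval_C, eval_C, Multiset.map_const',
    Multiset.prod_replicate, card_roots_charpoly]
  congr 1
  simp [algebraMap_eq_diagonal]

/-- At each `t` this is `det_aeval` for the polynomial `t - X ^ k`: spectral mapping with
multiplicities. -/
theorem charpoly_pow (A : Matrix n n K) (k : ℕ) :
    (A ^ k).charpoly = ((A.charpoly.roots.map (· ^ k)).map fun y => X - C y).prod := by
  refine Polynomial.funext fun t => ?_
  have h := det_aeval A (C t - X ^ k)
  rw [eval_charpoly, eval_multiset_prod, Multiset.map_map, Multiset.map_map]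
  simpa [algebraMap_eq_diagonal, Pi.algebraMap_def] using h

theorem trace_pow_eq_sum_roots_charpoly (A : Matrix n n K) (k : ℕ) :
    (A ^ k).trace = (A.charpoly.roots.map (· ^ k)).sum := by
  rw [trace_eq_sum_roots_charpoly, charpoly_pow, roots_multiset_prod_X_sub_C]

theorem det_one_sub_smul (A : Matrix n n K) (u : K) :
    (1 - u • A).det = (A.charpoly.roots.map fun y => 1 - u * y).prod := by
  have h := det_aeval A (1 - C u * X)
  rw [Algebra.smul_def]
  simpa using h

end Matrix

/-- Near `0`, the series `∑ tr (A ^ k) u ^ k / k` is a logarithm of `det (1 - u A)⁻¹`. -/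
theorem Matrix.exists_hasSum_trace_pow {n : Type*} [Fintype n] [DecidableEq n]
    (A : Matrix n n ℂ) (u : ℂ) (hu : ∀ y ∈ A.charpoly.roots, ‖u * y‖ < 1) :
    ∃ L : ℂ, Complex.exp L = ((1 - u • A).det)⁻¹ ∧ (1 - u • A).det ≠ 0 ∧
      HasSum (fun k : ℕ => (A ^ k).trace * (u ^ k / k)) L := by
  simp only [det_one_sub_smul, trace_pow_eq_sum_roots_charpoly]
  -- The claim now concerns an arbitrary multiset of numbers. The term `k = 0` vanishes because `u ^
  -- 0 / 0 = 0`.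
  generalize A.charpoly.roots = s at hu
  induction s using Multiset.induction_on with
  | empty => exact ⟨0, by simp, by simp, by simp⟩
  | cons a s ih =>
    obtain ⟨L, h1, h2, h3⟩ := ih fun y hy => hu y (Multiset.mem_cons_of_mem hy)
    have ha := hu a (Multiset.mem_cons_self a s)
    have hne : 1 - u * a ≠ 0 := fun h => by
      rw [← sub_eq_zero.mp h] at ha
      simp at ha
    refine ⟨-Complex.log (1 - u * a) + L, ?_, ?_, ?_⟩
    · rw [Complex.exp_add, h1, Complex.exp_neg, Complex.exp_log hne]
      simp [mul_comm]
    · simpa using ⟨hne, by simpa using h2⟩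
    · refine ((Complex.hasSum_taylorSeries_neg_log ha).add h3).congr_fun ?_
      intro k
      simp only [Multiset.map_cons, Multiset.sum_cons]
      ring

/-! ### Least periods and rotations of closed sequences -/

namespace ClosedSeq

variable {α : Type*}

/-- The shift of a sequence by one step. -/
def shift (f : ℕ → α) : ℕ → α := fun i => f (i + 1)

theorem shift_iterate (n : ℕ) (f : ℕ → α) (i : ℕ) : shift^[n] f i = f (i + n) := by
  induction n generalizing f with
  | zero => rfl
  | succ n ih => rw [Function.iterate_succ_apply, ih, shift, Nat.add_assoc]

theorem isPeriodicPt_shift_iff {n : ℕ} {f : ℕ → α} :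
    Function.IsPeriodicPt shift n f ↔ ∀ i, f (i + n) = f i := by
  simp only [Function.IsPeriodicPt, Function.IsFixedPt, funext_iff, shift_iterate]

theorem entry_mod (c : ClosedSeq α) (i : ℕ) : c.entry (i % c.length) = c.entry i := by
  conv_rhs => rw [← Nat.mod_add_div' i c.length, c.periodic_mul]

/-- The least period of the entries of a closed sequence. -/
noncomputable def period (c : ClosedSeq α) : ℕ := Function.minimalPeriod shift c.entry

theorem period_dvd_length (c : ClosedSeq α) : c.period ∣ c.length :=
  (isPeriodicPt_shift_iff.2 c.periodic).minimalPeriod_dvd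

theorem period_pos (c : ClosedSeq α) : 0 < c.period :=
  Nat.pos_of_dvd_of_pos c.period_dvd_length c.length_pos

theorem period_le {c : ClosedSeq α} {n : ℕ} (hn : 0 < n) (h : ∀ i, c.entry (i + n) = c.entry i) :
    c.period ≤ n :=
  (isPeriodicPt_shift_iff.2 h).minimalPeriod_le hn

/-- The closed sequence which goes once through the least period of `c`. -/
noncomputable def root (c : ClosedSeq α) : ClosedSeq α where
  length := c.period
  length_pos := c.period_pos
  entry := c.entry
  periodic := isPeriodicPt_shift_iff.1 (Function.isPeriodicPt_minimalPeriod _ _)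

theorem eq_root_multiple (c : ClosedSeq α) :
    ∃ m : ℕ+, (m : ℕ) * c.period = c.length ∧ c = c.root.multiple m := by
  obtain ⟨m, hm⟩ := c.period_dvd_length
  have hm0 : 0 < m := Nat.pos_of_ne_zero fun h => by
    have := c.length_pos
    rw [hm, h, Nat.mul_zero] at this
    exact this.false
  have h : ((⟨m, hm0⟩ : ℕ+) : ℕ) * c.period = c.length := by
    rw [hm, Nat.mul_comm]
  exact ⟨⟨m, hm0⟩, h, ClosedSeq.ext h.symm rfl⟩

/-- A closed sequence with a shift-independent property is not a proper multiple of another one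
if and only if its length is its least period. -/
theorem not_multiple_iff {P : (ℕ → α) → Prop} (c : ClosedSeq α) (hc : P c.entry) :
    (∀ (b : ClosedSeq α) (m : ℕ+), P b.entry → 2 ≤ m → c ≠ b.multiple m) ↔
      c.period = c.length := by
  constructor
  · intro h
    obtain ⟨m, hm, hcm⟩ := c.eq_root_multiple
    by_cases h2 : 2 ≤ m
    -- The root has the same entries as `c`, so `hc` serves for it too.
    · exact absurd hcm (h _ m hc h2)
    · have h1 : (m : ℕ) = 1 := le_antisymm (Nat.lt_succ_iff.1 (not_le.1 h2)) m.pos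
      rwa [h1, Nat.one_mul] at hm
  · rintro h b m - hm rfl
    have h1 : (b.multiple m).period ≤ b.length := period_le b.length_pos b.periodic
    have h2 : (b.multiple m).length = m * b.length := rfl
    have h3 : (2 : ℕ) ≤ m := hm
    have := b.length_pos
    nlinarith

/-- The cyclic permutation of `c` which starts at the entry `s`. -/
def rotate (c : ClosedSeq α) (s : ℕ) : ClosedSeq α where
  length := c.length
  length_pos := c.length_pos
  entry i := c.entry (i + s)
  periodic i := by rw [Nat.add_right_comm, c.periodic]

theorem rotate_isRotation (c : ClosedSeq α) (s : ℕ) : IsRotation c (c.rotate s) :=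
  ⟨rfl, s, fun _ => rfl⟩

theorem IsRotation.exists_rotate {c d : ClosedSeq α} (h : IsRotation c d) :
    ∃ s < c.length, c.rotate s = d := by
  obtain ⟨hl, s, hs⟩ := h
  refine ⟨s % c.length, Nat.mod_lt _ c.length_pos, ClosedSeq.ext hl.symm (funext fun i => ?_)⟩
  rw [hs]
  change c.entry (i + s % c.length) = _
  rw [← c.entry_mod, ← c.entry_mod (i + s), Nat.add_mod_mod]

theorem rotate_injOn {c : ClosedSeq α} (hc : c.period = c.length) {s t : ℕ} (hs : s < c.length)
    (ht : t < c.length) (h : c.rotate s = c.rotate t) : s = t := by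
  refine Function.iterate_injOn_Iio_minimalPeriod (f := shift) (x := c.entry)
    (hs.trans_eq hc.symm) (ht.trans_eq hc.symm) (funext fun i => ?_)
  simp only [shift_iterate]
  exact congrFun (congrArg entry h) i

/-- A period of a sequence is a period of each of its shifts; symmetry of rotation gives the other
inequality. -/
theorem IsRotation.period_eq {c d : ClosedSeq α} (h : IsRotation c d) : d.period = c.period := by
  have key : ∀ {c d : ClosedSeq α}, IsRotation c d → d.period ≤ c.period := by
    rintro c d ⟨-, s, hs⟩
    refine period_le c.period_pos fun i => ?_
    rw [hs, hs, Nat.add_right_comm]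
    exact c.root.periodic _
  exact le_antisymm (key h) (key ((rotationSetoid α).symm h))

end ClosedSeq

/-! ### Primitive admissible cycles and their classes -/

namespace Digraph

variable {α : Type*} (X : Digraph α)

theorem isPrimitive_iff (c : ClosedSeq X.OEdge) :
    X.IsPrimitive c ↔ X.IsAdmissibleClosed c ∧ c.period = c.length :=
  and_congr_right fun h => ClosedSeq.not_multiple_iff
    (P := fun f : ℕ → X.OEdge => ∀ i, (f (i + 1)).origin = (f i).terminus) c h

/-- The admissible closed paths of `X`. -/
abbrev AdmissibleClosed : Type _ := {c : ClosedSeq X.OEdge // X.IsAdmissibleClosed c}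

/-- Every admissible closed path is a multiple of a unique primitive one, in a unique way. -/
noncomputable def primitiveMultipleEquiv : X.PrimitiveCycle × ℕ+ ≃ X.AdmissibleClosed :=
  Equiv.ofBijective (fun q => ⟨q.1.1.multiple q.2, q.1.2.1⟩) <| by
    constructor
    · rintro ⟨⟨c, hc⟩, m⟩ ⟨⟨d, hd⟩, k⟩ h
      have h' : c.multiple m = d.multiple k := congrArg Subtype.val h
      -- Multiples keep the entries, and the length of a primitive cycle is the least period of its
      -- entries.
      have he : c.entry = d.entry := congrArg (fun c => c.entry) h'
      have hl : c.length = d.length := by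
        rw [← ((X.isPrimitive_iff c).1 hc).2, ← ((X.isPrimitive_iff d).1 hd).2,
          ClosedSeq.period, he, ClosedSeq.period]
      obtain rfl : c = d := ClosedSeq.ext hl he
      have hm : (m : ℕ) * c.length = k * c.length := congrArg (fun c => c.length) h'
      have : m = k := PNat.coe_injective (Nat.eq_of_mul_eq_mul_right c.length_pos hm)
      rw [this]
    · rintro ⟨c, hc⟩
      obtain ⟨m, -, hm⟩ := c.eq_root_multiple
      exact ⟨(⟨c.root, (X.isPrimitive_iff _).2 ⟨hc, rfl⟩⟩, m), Subtype.ext hm.symm⟩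

variable {X}

/-- There are `|c|` primitive admissible cycles in the class of `c`. -/
theorem nat_card_fiber (c : X.PrimitiveCycle) :
    Nat.card {d : X.PrimitiveCycle // (Quotient.mk _ d : X.PrimeCycle) = Quotient.mk _ c} =
      c.1.length := by
  obtain ⟨hc, hp⟩ := (X.isPrimitive_iff c.1).1 c.2
  have hrot : ∀ s, X.IsPrimitive (c.1.rotate s) := fun s => by
    refine (X.isPrimitive_iff _).2 ⟨fun i => ?_, (c.1.rotate_isRotation s).period_eq.trans hp⟩
    change (c.1.entry (i + 1 + s)).origin = (c.1.entry (i + s)).terminus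
    rw [Nat.add_right_comm]
    exact hc _
  rw [← Nat.card_fin c.1.length]
  refine (Nat.card_congr (Equiv.ofBijective (fun s : Fin c.1.length =>
    ⟨⟨c.1.rotate s, hrot s⟩, Quotient.sound (Setoid.symm (c.1.rotate_isRotation s))⟩) ⟨?_, ?_⟩)).symm
  · intro s t h
    exact Fin.ext (ClosedSeq.rotate_injOn hp s.2 t.2
      (congrArg (fun d => d.1.1) h))
  · rintro ⟨d, hd⟩
    have hd' : ClosedSeq.IsRotation c.1 d.1 := Setoid.symm (Quotient.exact hd)
    obtain ⟨s, hs, h⟩ := hd'.exists_rotate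
    exact ⟨⟨s, hs⟩, Subtype.ext (Subtype.ext h)⟩

end Digraph

/-! ### Closed walks and traces of powers -/

open scoped Classical in
/-- The entries of a power of `A` count walks. -/
theorem Matrix.pow_apply_eq_sum_walks {α R : Type*} [Fintype α] [CommSemiring R]
    (A : Matrix α α R) (k : ℕ) (x y : α) :
    (A ^ k) x y = ∑ f : Fin (k + 1) → α, if f 0 = x ∧ f (Fin.last k) = y then
      ∏ i : Fin k, A (f i.castSucc) (f i.succ) else 0 := by
  induction k generalizing x with
  | zero =>
    rw [← (Equiv.funUnique (Fin 1) α).symm.sum_comp]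
    simp only [pow_zero, Matrix.one_apply, Finset.univ_eq_empty, Finset.prod_empty]
    rw [Finset.sum_eq_single x]
    · simp [Equiv.funUnique]
    · intro b _ hb
      simp [Equiv.funUnique, hb]
    · simp
  | succ k ih =>
    rw [pow_succ', Matrix.mul_apply, ← (Fin.consEquiv fun _ : Fin (k + 2) => α).sum_comp,
      Fintype.sum_prod_type]
    simp only [ih, Fin.consEquiv_apply, Fin.cons_zero, Finset.mul_sum]
    -- With the tail `f` of the walk outermost, only the second vertex `f 0` and the first vertex
    -- `x` contribute.
    rw [Finset.sum_comm, Finset.sum_comm (γ := α)]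
    refine Finset.sum_congr rfl fun f _ => ?_
    rw [Finset.sum_eq_single (f 0), Finset.sum_eq_single x]
    · simp only [← Fin.succ_last, Fin.cons_succ, Fin.prod_univ_succ (n := k), Fin.castSucc_zero,
        Fin.cons_zero, true_and, mul_ite, mul_zero, Fin.castSucc_succ]
    · intro b _ hb
      simp [hb]
    · simp
    · intro b _ hb
      simp [hb.symm]
    · simp

namespace Digraph

variable {α : Type*} (X : Digraph α)

open scoped Classical in
/-- The adjacency matrix of an oriented graph. -/
noncomputable def adjacency : Matrix α α ℂ := Matrix.of fun x y => if X.Adj x y then 1 else 0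

/-- The walks of length `k` which end where they start. -/
def ClosedWalk (k : ℕ) : Type _ :=
  {f : Fin (k + 1) → α // f 0 = f (Fin.last k) ∧ ∀ i : Fin k, X.Adj (f i.castSucc) (f i.succ)}

open scoped Classical in
theorem trace_adjacency_pow [Fintype α] (k : ℕ) :
    (X.adjacency ^ k).trace = Nat.card (X.ClosedWalk k) := by
  simp only [Matrix.trace, Matrix.diag_apply, Matrix.pow_apply_eq_sum_walks]
  rw [Finset.sum_comm, ClosedWalk, Nat.card_eq_fintype_card, Fintype.card_subtype,
    Finset.card_filter, Nat.cast_sum]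
  refine Finset.sum_congr rfl fun f _ => ?_
  rw [Finset.sum_eq_single (f 0)]
  · simp only [adjacency, Matrix.of_apply, Finset.prod_ite_zero, true_and, eq_comm (a := f 0)]
    split_ifs <;> simp_all
  · intro b _ hb
    simp [hb.symm]
  · simp

variable {X}

/-- The walk through the origins of the edges of a closed path. -/
def walkOfClosed {k : ℕ} (c : {c : X.AdmissibleClosed // c.1.length = k}) : X.ClosedWalk k :=
  ⟨fun i => (c.1.1.entry i).origin, by
    have h := c.1.1.periodic 0
    rw [c.2, Nat.zero_add] at h
    simp [h], fun i => by
    have := c.1.2 i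
    have h2 := (c.1.1.entry i).adj
    simp only [Fin.val_castSucc, Fin.val_succ, this]
    exact h2⟩

/-- The closed path of a closed walk of positive length. -/
def closedOfWalk {k : ℕ} (hk : 0 < k) (f : X.ClosedWalk k) :
    {c : X.AdmissibleClosed // c.1.length = k} :=
  ⟨⟨{ length := k
      length_pos := hk
      entry := fun i => ⟨_, _, f.2.2 ⟨i % k, Nat.mod_lt _ hk⟩⟩
      periodic := fun i => by simp }, fun i => by
      change f.1 _ = f.1 _
      rcases (Nat.succ_le_of_lt (Nat.mod_lt i hk)).lt_or_eq with h | h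
      · refine congrArg f.1 (Fin.ext ?_)
        simp only [Fin.val_castSucc, Fin.val_succ]
        rw [← Nat.mod_add_mod, Nat.mod_eq_of_lt h]
      -- At the wrap-around the edge ends at the last vertex, which is the first one because the
      -- walk is closed.
      · have h1 : (i + 1) % k = 0 := by rw [← Nat.mod_add_mod, ← Nat.succ_eq_add_one, h, Nat.mod_self]
        have h2 : (Fin.castSucc ⟨(i + 1) % k, Nat.mod_lt _ hk⟩ : Fin (k + 1)) = 0 := by
          ext; simpa using h1
        have h3 : (Fin.succ ⟨i % k, Nat.mod_lt _ hk⟩ : Fin (k + 1)) = Fin.last k := by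
          ext; simpa using h
        rw [h2, h3]
        exact f.2.1⟩, rfl⟩

/-- Closed walks and closed paths of the same positive length correspond to each other. -/
def closedWalkEquiv {k : ℕ} (hk : 0 < k) :
    {c : X.AdmissibleClosed // c.1.length = k} ≃ X.ClosedWalk k where
  toFun := walkOfClosed
  invFun := closedOfWalk hk
  left_inv := by
    rintro ⟨⟨c, hc⟩, rfl⟩
    refine Subtype.ext (Subtype.ext (ClosedSeq.ext rfl (funext fun i => ?_)))
    rw [← c.entry_mod i]
    exact OEdge.ext rfl (hc _)
  right_inv f := by
    refine Subtype.ext (funext fun i => ?_)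
    change f.1 _ = f.1 _
    rcases (Nat.le_of_lt_succ i.2).lt_or_eq with h | h
    · refine congrArg f.1 (Fin.ext ?_)
      simp [Nat.mod_eq_of_lt h]
    · have h1 : i = Fin.last k := Fin.ext h
      subst h1
      rw [← f.2.1]
      refine congrArg f.1 (Fin.ext ?_)
      simp

instance finite_closedWalk [Finite α] (k : ℕ) : Finite (X.ClosedWalk k) :=
  Subtype.finite

theorem finite_closed [Finite α] (k : ℕ) : Finite {c : X.AdmissibleClosed // c.1.length = k} := by
  rcases k.eq_zero_or_pos with rfl | hk
  · exact @Finite.of_subsingleton _ ⟨fun c => absurd c.2 c.1.1.length_pos.ne'⟩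
  · exact Finite.of_equiv _ (closedWalkEquiv hk).symm

/-! ### The Euler product and the determinant -/

variable (X)

/-- Groups closed paths by length. The condition `g 0 = 0` is there because no closed path has
length `0`, while `tr (A ^ 0)` is the number of vertices. -/
theorem trace_mul_eq_tsum_fiber [Fintype α] [DecidableEq α] (g : ℕ → ℂ) (hg : g 0 = 0) (k : ℕ) :
    ∑' c : {c : X.AdmissibleClosed // c.1.length = k}, g c.1.1.length =
      (X.adjacency ^ k).trace * g k := by
  have h : ∀ c : {c : X.AdmissibleClosed // c.1.length = k}, g c.1.1.length = g k :=
    fun c => congrArg g c.2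
  simp only [h, tsum_const]
  rcases k.eq_zero_or_pos with rfl | hk
  · simp [hg]
  · rw [Nat.card_congr (closedWalkEquiv hk), nsmul_eq_mul, ← trace_adjacency_pow]
    congr!

/-- The sum of `u ^ |c| / |c|` over all admissible closed paths `c`. -/
theorem exists_hasSum_closed [Fintype α] [DecidableEq α] (u : ℂ)
    (hu : ∀ y ∈ X.adjacency.charpoly.roots, ‖u * y‖ < 1) :
    ∃ L : ℂ, Complex.exp L = ((1 - u • X.adjacency).det)⁻¹ ∧ (1 - u • X.adjacency).det ≠ 0 ∧
      HasSum (fun c : X.AdmissibleClosed => u ^ c.1.length / (c.1.length : ℂ)) L := by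
  obtain ⟨L, h1, h2, h3⟩ := X.adjacency.exists_hasSum_trace_pow u hu
  refine ⟨L, h1, h2, ?_⟩
  -- Absolute convergence comes from the trace series at `‖u‖`: the bound on eigenvalues involves
  -- only the norm of `u`.
  have hs : Summable fun c : X.AdmissibleClosed => u ^ c.1.length / (c.1.length : ℂ) := by
    obtain ⟨_, -, -, h⟩ := X.adjacency.exists_hasSum_trace_pow (‖u‖ : ℂ)
      (fun y hy => by simpa using hu y hy)
    refine Summable.of_norm ?_
    rw [← (Equiv.sigmaFiberEquiv fun c : X.AdmissibleClosed => c.1.length).summable_iff,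
      Function.comp_def]
    refine (summable_sigma_of_nonneg fun _ => norm_nonneg _).2 ⟨?_, ?_⟩
    · intro k
      have := finite_closed (X := X) k
      exact Summable.of_finite
    · rw [← Complex.summable_ofReal]
      refine h.summable.congr fun k => ?_
      rw [← X.trace_mul_eq_tsum_fiber (fun k => (‖u‖ : ℂ) ^ k / (k : ℂ)) (by simp),
        Complex.ofReal_tsum]
      refine tsum_congr fun c => ?_
      simp [Equiv.sigmaFiberEquiv]
  have h := hs.hasSum.tsum_fiberwise fun c => c.1.length
  have h' : (fun k : ℕ => ∑' c : (fun c : X.AdmissibleClosed => c.1.length) ⁻¹' {k},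
      u ^ c.1.1.length / (c.1.1.length : ℂ)) =
      fun k : ℕ => (X.adjacency ^ k).trace * (u ^ k / k) := by
    funext k
    exact X.trace_mul_eq_tsum_fiber (fun k => u ^ k / (k : ℂ)) (by simp) k
  rw [h'] at h
  rw [← h.unique h3]
  exact hs.hasSum

/-- The Euler product over the admissible prime cycles near `0`. -/
theorem hasProd_primeCycle [Fintype α] [DecidableEq α] (u : ℂ) (hu1 : ‖u‖ < 1)
    (hu : ∀ y ∈ X.adjacency.charpoly.roots, ‖u * y‖ < 1) :
    (1 - u • X.adjacency).det ≠ 0 ∧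
      HasProd (fun p : X.PrimeCycle => (1 - u ^ p.length)⁻¹) ((1 - u • X.adjacency).det)⁻¹ := by
  obtain ⟨L, h1, h2, h3⟩ := X.exists_hasSum_closed u hu
  refine ⟨h2, ?_⟩
  have hn : ∀ l : ℕ, 0 < l → ‖u ^ l‖ < 1 := fun l hl => by
    rw [norm_pow]
    exact pow_lt_one₀ (norm_nonneg u) hu1 hl.ne'
  rw [← X.primitiveMultipleEquiv.hasSum_iff] at h3
  have h4 : HasSum (fun q : X.PrimitiveCycle =>
      -Complex.log (1 - u ^ q.1.length) / (q.1.length : ℂ)) L := by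
    refine h3.prod_fiberwise fun q => ?_
    have h := Complex.hasSum_taylorSeries_neg_log (hn _ q.1.length_pos)
    -- The term `n = 0` of the logarithm series is `0`, so the series can be indexed by `ℕ+`.
    have h' := (hasSum_subtype_iff_of_support_subset (s := {n : ℕ | 0 < n}) (fun n hn => by
      rcases n.eq_zero_or_pos with rfl | h0
      · simp at hn
      · exact h0)).2 h
    refine (h'.div_const (q.1.length : ℂ)).congr_fun fun m => ?_
    change u ^ ((m : ℕ) * q.1.length) / (((m : ℕ) * q.1.length : ℕ) : ℂ) = _
    simp only [Function.comp_apply, ← pow_mul, Nat.cast_mul, div_div]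
    rw [Nat.mul_comm]
  -- Over the class of `q` there are `|q|` equal terms, which cancel the factor `1 / |q|`.
  have h5 := h4.tsum_fiberwise fun q => (Quotient.mk _ q : X.PrimeCycle)
  rw [← h1]
  refine h5.cexp.congr_fun fun p => ?_
  obtain ⟨q, rfl⟩ := Quotient.exists_rep p
  have hq : ∀ d : (fun q => (Quotient.mk _ q : X.PrimeCycle)) ⁻¹' {Quotient.mk _ q},
      -Complex.log (1 - u ^ d.1.1.length) / (d.1.1.length : ℂ) =
        -Complex.log (1 - u ^ q.1.length) / (q.1.length : ℂ) := fun d => by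
    have : d.1.1.length = q.1.length :=
      (congrArg PrimeCycle.length (d.2 : (Quotient.mk _ d.1 : X.PrimeCycle) = Quotient.mk _ q))
    rw [this]
  have hc : Nat.card ((fun q => (Quotient.mk _ q : X.PrimeCycle)) ⁻¹' {Quotient.mk _ q}) =
      q.1.length := nat_card_fiber q
  have hl : (q.1.length : ℂ) ≠ 0 := Nat.cast_ne_zero.2 q.1.length_pos.ne'
  have hne : 1 - u ^ q.1.length ≠ 0 := fun h => by
    have := hn _ q.1.length_pos
    rw [← sub_eq_zero.mp h] at this
    simp at this
  simp only [Function.comp_apply, hq, tsum_const, hc, nsmul_eq_mul]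
  rw [mul_div_cancel₀ _ hl, Complex.exp_neg, Complex.exp_log hne]
  rfl

theorem toMatrix_perronFrobenius [Fintype α] [DecidableEq α] :
    LinearMap.toMatrix' X.perronFrobenius = X.adjacency := by
  ext x y
  rw [LinearMap.toMatrix'_apply]
  simp only [perronFrobenius, LinearMap.coe_mk, AddHom.coe_mk]
  simp only [Pi.single_apply, Finset.sum_ite_eq', adjacency, Matrix.of_apply]
  by_cases h : X.Adj x y <;> simp [h]

theorem det_one_sub_smul_perronFrobenius [Fintype α] [DecidableEq α] (u : ℂ) :
    LinearMap.det (1 - u • X.perronFrobenius) = (1 - u • X.adjacency).det := by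
  rw [← LinearMap.det_toMatrix', map_sub, map_smul, toMatrix_perronFrobenius,
    LinearMap.toMatrix'_one]

end Digraph

/-! ### Prime cycles of the hypergraph and its oriented line graph -/

namespace MultiHypergraph

variable {V E : Type*} (H : MultiHypergraph V E)

/-- The closed paths without cyclic hyperedge backtracking, as a property of the entries. -/
def IsReduced (f : ℕ → V × E) : Prop :=
  (∀ i, (f i).1 ∈ H.verts (f i).2 ∧ (f (i + 1)).1 ∈ H.verts (f i).2 ∧ (f i).1 ≠ (f (i + 1)).1) ∧
    ∀ i, (f i).2 ≠ (f (i + 1)).2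

/-- Going around twice also meets the passage from the last hyperedge to the first; by periodicity
this covers every index. -/
theorem not_hasBacktracking_and_isTailless_iff (c : ClosedSeq (V × E)) :
    ¬ HasBacktracking c ∧ IsTailless c ↔ ∀ i, (c.entry i).2 ≠ (c.entry (i + 1)).2 := by
  constructor
  · rintro ⟨-, h⟩ i hi
    refine h ⟨i % c.length, ?_, ?_⟩
    · change i % c.length + 1 < 2 * c.length
      have := Nat.mod_lt i c.length_pos
      omega
    · change (c.entry (i % c.length)).2 = (c.entry (i % c.length + 1)).2
      rwa [c.entry_mod, ← c.entry_mod (i % c.length + 1), Nat.mod_add_mod, c.entry_mod]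
  · exact fun h => ⟨fun ⟨i, _, hi⟩ => h i hi, fun ⟨i, _, hi⟩ => h i hi⟩

theorem isPrimitive_iff (c : ClosedSeq (V × E)) :
    H.IsPrimitive c ↔ H.IsReduced c.entry ∧ c.period = c.length := by
  rw [IsReduced, and_assoc, IsPrimitive]
  refine and_congr_right fun h => ?_
  rw [← and_assoc, not_hasBacktracking_and_isTailless_iff]
  exact and_congr_right fun _ => ClosedSeq.not_multiple_iff (P := fun f : ℕ → V × E => ∀ i,
    (f i).1 ∈ H.verts (f i).2 ∧ (f (i + 1)).1 ∈ H.verts (f i).2 ∧ (f i).1 ≠ (f (i + 1)).1) c h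

variable {H}

/-- The step `i` of a reduced closed path, as a vertex of the oriented line graph. -/
def IsReduced.coloredEdge {f : ℕ → V × E} (h : H.IsReduced f) (i : ℕ) : H.ColoredEdge where
  origin := (f i).1
  terminus := (f (i + 1)).1
  color := (f i).2
  origin_mem := (h.1 i).1
  terminus_mem := (h.1 i).2.1
  origin_ne_terminus := (h.1 i).2.2

/-- The steps `i` and `i + 1` of a reduced closed path, as an edge of the oriented line graph. -/
def IsReduced.lineEdge {f : ℕ → V × E} (h : H.IsReduced f) (i : ℕ) :
    H.orientedLineGraph.OEdge where
  origin := h.coloredEdge i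
  terminus := h.coloredEdge (i + 1)
  adj := ⟨h.2 i, rfl⟩

/-- The edge at `i` records `f i`, and is determined by `f i`, `f (i + 1)` and `f (i + 2)`; hence
the code has the same periods as `f`. -/
theorem IsReduced.lineEdge_eq_iff {f : ℕ → V × E} (h : H.IsReduced f) (n : ℕ) :
    (∀ i, h.lineEdge (i + n) = h.lineEdge i) ↔ ∀ i, f (i + n) = f i := by
  constructor
  · intro hn i
    exact Prod.ext (congrArg (fun e => e.origin.origin) (hn i))
      (congrArg (fun e => e.origin.color) (hn i))
  · intro hn i
    have h1 : ∀ i, h.coloredEdge (i + n) = h.coloredEdge i := fun i => by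
      refine ColoredEdge.ext (congrArg Prod.fst (hn i)) ?_ (congrArg Prod.snd (hn i))
      change (f (i + n + 1)).1 = _
      rw [Nat.add_right_comm, hn]
      rfl
    refine Digraph.OEdge.ext (h1 i) ?_
    change h.coloredEdge (i + n + 1) = _
    rw [Nat.add_right_comm, h1]
    rfl

/-- The closed path in the oriented line graph given by a reduced closed path. -/
def lineSeq (c : ClosedSeq (V × E)) (h : H.IsReduced c.entry) :
    ClosedSeq H.orientedLineGraph.OEdge where
  length := c.length
  length_pos := c.length_pos
  entry := h.lineEdge
  periodic := (h.lineEdge_eq_iff c.length).2 c.periodic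

theorem period_lineSeq (c : ClosedSeq (V × E)) (h : H.IsReduced c.entry) :
    (lineSeq c h).period = c.period := by
  refine le_antisymm ?_ ?_
  · exact ClosedSeq.period_le c.period_pos ((h.lineEdge_eq_iff _).2 c.root.periodic)
  · exact ClosedSeq.period_le (lineSeq c h).period_pos
      ((h.lineEdge_eq_iff _).1 (lineSeq c h).root.periodic)

/-- The reduced closed path given by a closed path in the oriented line graph. -/
def unlineSeq (d : ClosedSeq H.orientedLineGraph.OEdge) : ClosedSeq (V × E) where
  length := d.length
  length_pos := d.length_pos
  entry i := ((d.entry i).origin.origin, (d.entry i).origin.color)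
  periodic i := by rw [d.periodic]

theorem isReduced_unlineSeq {d : ClosedSeq H.orientedLineGraph.OEdge}
    (hd : H.orientedLineGraph.IsAdmissibleClosed d) : H.IsReduced (unlineSeq d).entry := by
  have h : ∀ i, (d.entry i).origin.terminus = (d.entry (i + 1)).origin.origin := fun i => by
    rw [hd i]
    exact (d.entry i).adj.2
  refine ⟨fun i => ⟨(d.entry i).origin.origin_mem, ?_, ?_⟩, fun i => ?_⟩
  · change (d.entry (i + 1)).origin.origin ∈ _
    rw [← h]
    exact (d.entry i).origin.terminus_mem
  · change _ ≠ (d.entry (i + 1)).origin.origin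
    rw [← h]
    exact (d.entry i).origin.origin_ne_terminus
  · change _ ≠ (d.entry (i + 1)).origin.color
    rw [hd i]
    exact (d.entry i).adj.1

/-- The termini forgotten by `unlineSeq` are recovered from adjacency: each is the origin of the
next coloured edge. -/
theorem lineSeq_unlineSeq {d : ClosedSeq H.orientedLineGraph.OEdge}
    (hd : H.orientedLineGraph.IsAdmissibleClosed d) :
    lineSeq (unlineSeq d) (isReduced_unlineSeq hd) = d := by
  have h : ∀ i, (isReduced_unlineSeq hd).coloredEdge i = (d.entry i).origin := fun i => by
    refine ColoredEdge.ext rfl ?_ rfl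
    change (d.entry (i + 1)).origin.origin = _
    rw [hd i]
    exact (d.entry i).adj.2.symm
  exact ClosedSeq.ext rfl (funext fun i => Digraph.OEdge.ext (h i) ((h (i + 1)).trans (hd i)))

variable (H)

/-- Primitive cycles of `H` correspond to primitive admissible cycles of its oriented line
graph. -/
def primitiveEquiv : H.PrimitiveCycle ≃ H.orientedLineGraph.PrimitiveCycle where
  toFun c := ⟨lineSeq c.1 ((H.isPrimitive_iff _).1 c.2).1,
    (Digraph.isPrimitive_iff _ _).2 ⟨fun _ => rfl,
      (period_lineSeq _ _).trans ((H.isPrimitive_iff _).1 c.2).2⟩⟩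
  invFun d := ⟨unlineSeq d.1, (H.isPrimitive_iff _).2 ⟨isReduced_unlineSeq d.2.1, by
    rw [← period_lineSeq _ (isReduced_unlineSeq d.2.1), lineSeq_unlineSeq d.2.1]
    exact ((Digraph.isPrimitive_iff _ _).1 d.2).2⟩⟩
  left_inv c := rfl
  right_inv d := Subtype.ext (lineSeq_unlineSeq d.2.1)

/-- Prime cycles of `H` correspond to admissible prime cycles of its oriented line graph. -/
def primeEquiv : H.PrimeCycle ≃ H.orientedLineGraph.PrimeCycle :=
  Quotient.congr H.primitiveEquiv fun c d => by
    change ClosedSeq.IsRotation _ _ ↔ ClosedSeq.IsRotation _ _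
    refine and_congr Iff.rfl (exists_congr fun s => ⟨fun h i => ?_, fun h i => ?_⟩)
    · have h1 : ∀ i, ((H.isPrimitive_iff _).1 d.2).1.coloredEdge i =
          ((H.isPrimitive_iff _).1 c.2).1.coloredEdge (i + s) := fun i => by
        refine ColoredEdge.ext (congrArg Prod.fst (h i)) ?_ (congrArg Prod.snd (h i))
        change (d.1.entry (i + 1)).1 = (c.1.entry (i + s + 1)).1
        rw [h, Nat.add_right_comm]
      refine Digraph.OEdge.ext (h1 i) ((h1 (i + 1)).trans ?_)
      rw [Nat.add_right_comm]
      rfl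
    · exact Prod.ext (congrArg (fun e => e.origin.origin) (h i))
        (congrArg (fun e => e.origin.color) (h i))

theorem length_primeEquiv (p : H.PrimeCycle) : (H.primeEquiv p).length = p.length := by
  obtain ⟨c, rfl⟩ := Quotient.exists_rep p
  rfl

end MultiHypergraph

theorem mainTheorem4 {V E : Type*} [Finite V] [Finite E] (H : MultiHypergraph V E) :
    -- a length-preserving bijection from prime cycles of `H` to admissible prime cycles of the
    -- oriented line graph, given by `(v_i, e_i)_i ↦ ({v_i, v_{i+1}}_{e_i})_i`
    (∃ Φ : H.PrimeCycle ≃ H.orientedLineGraph.PrimeCycle,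
      (∀ p, (Φ p).length = p.length) ∧
      ∀ c : H.PrimitiveCycle, ∃ d : H.orientedLineGraph.PrimitiveCycle,
        Φ (Quotient.mk _ c) = Quotient.mk _ d ∧ d.1.length = c.1.length ∧
        ∀ i, (d.1.entry i).origin.origin = (c.1.entry i).1 ∧
          (d.1.entry i).origin.terminus = (c.1.entry (i + 1)).1 ∧
          (d.1.entry i).origin.color = (c.1.entry i).2) ∧
    ∃ r : ℝ, 0 < r ∧
      -- the Euler product converges near `0`, and it is the inverse of the determinant
      (∀ u : ℂ, ‖u‖ < r →
        Multipliable (H.eulerFactor u) ∧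
        LinearMap.det (1 - u • H.orientedLineGraph.perronFrobenius) ≠ 0 ∧
        H.zeta u = (LinearMap.det (1 - u • H.orientedLineGraph.perronFrobenius))⁻¹) ∧
      -- the zeta function is rational: it is one divided by a polynomial
      ∃ Q : ℂ[X], ∀ u : ℂ, ‖u‖ < r → Q.eval u ≠ 0 ∧ H.zeta u = 1 / Q.eval u := by
  classical
  refine ⟨⟨H.primeEquiv, H.length_primeEquiv, fun c => ⟨H.primitiveEquiv c, rfl, rfl,
    fun i => ⟨rfl, rfl, rfl⟩⟩⟩, ?_⟩
  set A := H.orientedLineGraph.adjacency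
  -- `s` bounds every `‖y‖`, so `‖u‖ < 1 / (1 + s)` forces both `‖u‖ < 1` and `‖u * y‖ < 1`.
  set s := (A.charpoly.roots.map fun y => ‖y‖).sum
  have hs0 : 0 ≤ s := Multiset.sum_nonneg fun x hx => by
    obtain ⟨y, -, rfl⟩ := Multiset.mem_map.1 hx
    exact norm_nonneg y
  have hsmall : ∀ u : ℂ, ‖u‖ < 1 / (1 + s) → ‖u‖ < 1 ∧ ∀ y ∈ A.charpoly.roots, ‖u * y‖ < 1 := by
    intro u hu
    rw [lt_div_iff₀ (by positivity)] at hu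
    have hu0 := norm_nonneg u
    refine ⟨by nlinarith, fun y hy => ?_⟩
    have hy' : ‖y‖ ≤ s := Multiset.single_le_sum (fun x hx => by
      obtain ⟨y, -, rfl⟩ := Multiset.mem_map.1 hx
      exact norm_nonneg y) _ (Multiset.mem_map_of_mem _ hy)
    rw [norm_mul]
    nlinarith
  have hzeta : ∀ u : ℂ, ‖u‖ < 1 / (1 + s) → (1 - u • A).det ≠ 0 ∧
      HasProd (H.eulerFactor u) ((1 - u • A).det)⁻¹ := by
    intro u hu
    obtain ⟨h1, h2⟩ := hsmall u hu
    obtain ⟨h3, h4⟩ := H.orientedLineGraph.hasProd_primeCycle u h1 h2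
    refine ⟨h3, (H.primeEquiv.hasProd_iff.2 h4).congr_fun fun p => ?_⟩
    simp [MultiHypergraph.eulerFactor, MultiHypergraph.length_primeEquiv]
  refine ⟨1 / (1 + s), by positivity, fun u hu => ?_,
    -- `Q` is `det (1 - u A)` as a polynomial in `u`, written through the eigenvalues.
    (A.charpoly.roots.map fun y => 1 - Polynomial.X * Polynomial.C y).prod, fun u hu => ?_⟩
  · obtain ⟨h1, h2⟩ := hzeta u hu
    rw [Digraph.det_one_sub_smul_perronFrobenius]
    exact ⟨h2.multipliable, h1, h2.tprod_eq⟩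
  · obtain ⟨h1, h2⟩ := hzeta u hu
    have h3 : Polynomial.eval u
        (A.charpoly.roots.map fun y => 1 - Polynomial.X * Polynomial.C y).prod =
        (1 - u • A).det := by
      rw [Matrix.det_one_sub_smul, Polynomial.eval_multiset_prod, Multiset.map_map]
      simp [mul_comm u]
    rw [h3, one_div]
    exact ⟨h1, h2.tprod_eq⟩
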